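/- For a lattice $A$ with zero and a lattice $B$ with zero, a \emph{bi-ideal} of $A\times B$ is a hereditary subset (lower set) of $A\times B$ that contains $\bot_{A,B}=(A\times\{0_B\})\cup(\{0_A\}\times B)$ and is closed under lateral joins: if $(a_0,b)$ and $(a_1,b)$ belong to it, so does $(a_0\vee a_1,b)$, and if $(a,b_0)$ and $(a,b_1)$ belong to it, so does $(a,b_0\vee b_1)$. The \emph{tensor product} $A\otimes B$ is the set of all compact elements of the complete lattice of all bi-ideals of $A\times B$, ordered by inclusion. It is \emph{capped} if for every $I\in A\otimes B$ there is a finite set $\Gamma\subseteq A\times B$ such that $I$ is the hereditary subset of $A\times B$ generated by $\Gamma\cup\bot_{A,B}$. For a triple $u=(x,y,z)$ of elements of a lattice $L$, put $u^{(0)}=u$, $u^{(1)}=(x\vee(y\wedge z),\,y\vee(x\wedge z),\,z\vee(x\wedge y))$ and $u^{(k+1)}=(u^{(k)})^{(1)}$; the lattice $L$ is \emph{$2$-modular} if $u^{(3)}=u^{(2)}$ for all $u\in L^3$. A lattice is \emph{three-generated} if it is generated by a three-element subset, and \emph{locally finite} if each of its finite subsets generates a finite sublattice. \textbf{Theorem.}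 There exists an infinite, three-generated, $2$-modular lattice $K$ with zero such that $K\otimes K$ is a capped tensor product. Consequently, it is not true that, for all lattices $A$ and $B$ with zero, if $A\otimes B$ is a capped tensor product, then $A$ or $B$ is locally finite. -/

import Mathlib

/-- A bi-ideal of `A × B`, for join-semilattices with zero `A` and `B`: a hereditary subset of
`A × B` that contains `(A × {0}) ∪ ({0} × B)` and is closed under lateral joins. -/
@[ext]
structure BiIdeal (A B : Type*) [SemilatticeSup A] [OrderBot A] [SemilatticeSup B] [OrderBot B] where
  /-- The underlying set of pairs. -/
  carrier : Set (A × B)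
  hereditary : IsLowerSet carrier
  mk_bot_mem : ∀ a : A, (a, ⊥) ∈ carrier
  bot_mk_mem : ∀ b : B, (⊥, b) ∈ carrier
  sup_left_mem : ∀ (a₀ a₁ : A) (b : B),
    (a₀, b) ∈ carrier → (a₁, b) ∈ carrier → (a₀ ⊔ a₁, b) ∈ carrier
  sup_right_mem : ∀ (a : A) (b₀ b₁ : B),
    (a, b₀) ∈ carrier → (a, b₁) ∈ carrier → (a, b₀ ⊔ b₁) ∈ carrier

namespace BiIdeal

variable {A B : Type*} [SemilatticeSup A] [OrderBot A] [SemilatticeSup B] [OrderBot B]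

/-- Bi-ideals are ordered by inclusion; with this order, `BiIdeal A B` is the extended tensor
product of `A` and `B`. -/
instance : PartialOrder (BiIdeal A B) :=
  PartialOrder.lift BiIdeal.carrier (fun _ _ h => BiIdeal.ext h)

/-- The subset `(A × {0}) ∪ ({0} × B)` of `A × B`, contained in every bi-ideal. -/
def botSet (A B : Type*) [SemilatticeSup A] [OrderBot A] [SemilatticeSup B] [OrderBot B] :
    Set (A × B) :=
  {p | p.1 = ⊥ ∨ p.2 = ⊥}

/-- `Γ` is a capping of `I` if `I` is the hereditary subset of `A × B` generated by `Γ` together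
with `(A × {0}) ∪ ({0} × B)`. -/
def IsCapping (I : BiIdeal A B) (Γ : Set (A × B)) : Prop :=
  I.carrier = (lowerClosure (Γ ∪ botSet A B) : Set (A × B))

/-- A bi-ideal is capped if it has a finite capping. -/
def IsCapped (I : BiIdeal A B) : Prop :=
  ∃ Γ : Set (A × B), Γ.Finite ∧ I.IsCapping Γ

end BiIdeal

/-- The tensor product of `A` and `B`: the set of all compact elements of the extended tensor
product. -/
def tensorProd (A B : Type*) [SemilatticeSup A] [OrderBot A] [SemilatticeSup B] [OrderBot B] :
    Set (BiIdeal A B) :=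
  {I | IsCompactElement I}

/-- The tensor product of `A` and `B` is capped if all its elements are capped bi-ideals. -/
def IsCappedTensorProd (A B : Type*) [SemilatticeSup A] [OrderBot A] [SemilatticeSup B]
    [OrderBot B] : Prop :=
  ∀ I ∈ tensorProd A B, I.IsCapped

/-- The map `u ↦ u⁽¹⁾` on triples of elements of a lattice. -/
def tripleStep {L : Type*} [Lattice L] (u : L × L × L) : L × L × L :=
  (u.1 ⊔ (u.2.1 ⊓ u.2.2), u.2.1 ⊔ (u.1 ⊓ u.2.2), u.2.2 ⊔ (u.1 ⊓ u.2.1))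

/-- A lattice is `h`-modular (for a positive integer `h`) if `u⁽ʰ⁺¹⁾ = u⁽ʰ⁾` for every triple `u`
of its elements. -/
def IsHModular (h : ℕ) (L : Type*) [Lattice L] : Prop :=
  ∀ u : L × L × L, tripleStep^[h + 1] u = tripleStep^[h] u

/-- A lattice is three-generated if it is generated, as a lattice, by a three-element subset. -/
def IsThreeGenerated (L : Type*) [Lattice L] : Prop :=
  ∃ s : Finset L, s.card = 3 ∧ latticeClosure (s : Set L) = Set.univ

/-- A lattice is locally finite if each of its finite subsets generates a finite sublattice. -/
def IsLocallyFiniteLattice (L : Type*) [Lattice L] : Prop :=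
  ∀ s : Set L, s.Finite → (latticeClosure s).Finite

/-!
The lattice `K` is the *descending herringbone*: a spine `s₀ > s₁ > ⋯ > s_∞` with two chains of teeth
`u₀ > u₁ > ⋯ > u_∞` and `v₀ > v₁ > ⋯ > v_∞` and a zero, such that `uₙ ∧ vₘ = 0` and
`u_∞ ∨ vₙ = s₂ₙ₊₁`, `uₙ ∨ v_∞ = s₂ₙ`, `u₀ ∧ s₂ₙ₊₁ = uₙ₊₁`, `v₀ ∧ s₂ₙ = vₙ`.

* The last four equations and `u₀ ∧ v₀ = 0` generate `K` from `u₀`, `v₀` and `s_∞`, because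
  `u_∞ = u₀ ∧ s_∞` and `v_∞ = v₀ ∧ s_∞` (`latticeClosure_generators`).
* In any lattice, `u⁽³⁾ = u⁽²⁾` holds for a triple with two comparable entries
  (`isFixedPt_tripleStep_iterate_of_le`). An antichain of three elements of `K` has one element on
  the spine and one on each chain of teeth, so `u⁽¹⁾` lies on the spine, which is a chain, and
  `u⁽²⁾` is fixed (`Herringbone.isHModular_two`).
* `K` is a union of finitely many dually well-ordered chains, so the dual of `K × K` is
  well-quasi-ordered. Hence every lower set of `K × K` is generated by its maximal elements, which
  form a finite antichain, and every bi-ideal whatsoever is capped (`BiIdeal.isCapped`).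

Since `K` is infinite and three-generated, it is not locally finite, and `A = B = K` refutes the
implication in the second half.
-/

/-! ### Triples with a comparable pair -/

section Triples

variable {L : Type*} [Lattice L]

theorem isFixedPt_tripleStep_iff {x y z : L} :
    Function.IsFixedPt tripleStep (x, y, z) ↔ y ⊓ z ≤ x ∧ x ⊓ z ≤ y ∧ x ⊓ y ≤ z := by
  simp [Function.IsFixedPt, tripleStep]

theorem tripleStep_semiconj_swap :
    Function.Semiconj (fun u : L × L × L => (u.2.1, u.1, u.2.2)) tripleStep tripleStep := by
  intro u
  simp [tripleStep, inf_comm]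

theorem tripleStep_semiconj_rotate :
    Function.Semiconj (fun u : L × L × L => (u.2.1, u.2.2, u.1)) tripleStep tripleStep := by
  intro u
  simp [tripleStep, inf_comm]

/-- If `x ≤ y`, then `(x, y, z)⁽²⁾ = (y ∧ (z ∨ x), y, z ∨ x)`. -/
theorem isFixedPt_tripleStep_iterate_of_le {x y : L} (h : x ≤ y) (z : L) :
    Function.IsFixedPt tripleStep (tripleStep^[2] (x, y, z)) := by
  have h₁ : tripleStep (x, y, z) = (x ⊔ y ⊓ z, y, z ⊔ x) := by
    simp [tripleStep, h, inf_le_of_left_le]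
  have h₂ : tripleStep^[2] (x, y, z) = (y ⊓ (z ⊔ x), y, z ⊔ x) := by
    have hx : x ⊔ y ⊓ z ≤ y ⊓ (z ⊔ x) :=
      sup_le (le_inf h le_sup_right) (inf_le_inf_left y le_sup_left)
    rw [Function.iterate_succ_apply', Function.iterate_one, h₁]
    simp only [tripleStep, Prod.mk.injEq]
    exact ⟨sup_eq_right.2 hx, sup_eq_left.2 (inf_le_left.trans (hx.trans inf_le_left)),
      sup_eq_left.2 (inf_le_left.trans (hx.trans inf_le_right))⟩
  rw [h₂, isFixedPt_tripleStep_iff]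
  exact ⟨le_rfl, inf_le_left.trans inf_le_left, inf_le_left.trans inf_le_right⟩

/-- The property is invariant under permutations, so the position of the comparable pair does not
matter. -/
theorem isFixedPt_tripleStep_iterate_of_comparable {x y z : L}
    (h : x ≤ y ∨ y ≤ x ∨ y ≤ z ∨ z ≤ y ∨ z ≤ x ∨ x ≤ z) :
    Function.IsFixedPt tripleStep (tripleStep^[2] (x, y, z)) := by
  have swap : ∀ x y z : L, Function.IsFixedPt tripleStep (tripleStep^[2] (x, y, z)) →
      Function.IsFixedPt tripleStep (tripleStep^[2] (y, x, z)) := fun x y z H => by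
    simpa only [← (tripleStep_semiconj_swap.iterate_right 2).eq (x, y, z)] using
      H.map tripleStep_semiconj_swap
  have rotate : ∀ x y z : L, Function.IsFixedPt tripleStep (tripleStep^[2] (x, y, z)) →
      Function.IsFixedPt tripleStep (tripleStep^[2] (y, z, x)) := fun x y z H => by
    simpa only [← (tripleStep_semiconj_rotate.iterate_right 2).eq (x, y, z)] using
      H.map tripleStep_semiconj_rotate
  have key : ∀ x y z : L, x ≤ y ∨ y ≤ x →
      Function.IsFixedPt tripleStep (tripleStep^[2] (x, y, z)) := fun x y z H =>
    H.elim (isFixedPt_tripleStep_iterate_of_le · z)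
      fun H => swap _ _ _ (isFixedPt_tripleStep_iterate_of_le H z)
  rcases h with h | h | h | h | h | h
  · exact key _ _ _ (.inl h)
  · exact key _ _ _ (.inr h)
  · exact rotate _ _ _ (rotate _ _ _ (key y z x (.inl h)))
  · exact rotate _ _ _ (rotate _ _ _ (key y z x (.inr h)))
  · exact rotate _ _ _ (key z x y (.inl h))
  · exact rotate _ _ _ (key z x y (.inr h))

theorem isFixedPt_tripleStep_tripleStep_of_chain {x y z : L} (hxy : x ≤ y ∨ y ≤ x)
    (hyz : y ≤ z ∨ z ≤ y) (hxz : x ≤ z ∨ z ≤ x) :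
    Function.IsFixedPt tripleStep (tripleStep (x, y, z)) := by
  simp only [tripleStep, isFixedPt_tripleStep_iff]
  rcases hxy with a | a <;> rcases hyz with b | b <;> rcases hxz with c | c <;>
    simp [a, b, c, a.trans, b.trans, c.trans]

end Triples

/-! ### Bi-ideals over dually well-quasi-ordered lattices -/

/-- Every element of a bi-ideal lies below a maximal one, and the maximal ones form an antichain of
the dual of `A × B`, which is finite by well-quasi-ordering. -/
theorem BiIdeal.isCapped {A B : Type*} [SemilatticeSup A] [OrderBot A] [SemilatticeSup B]
    [OrderBot B] [WellQuasiOrderedLE Aᵒᵈ] [WellQuasiOrderedLE Bᵒᵈ] (I : BiIdeal A B) :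
    I.IsCapped := by
  have hwqo : WellQuasiOrdered ((· ≥ ·) : A × B → A × B → Prop) :=
    WellQuasiOrdered.prod (r := ((· ≥ ·) : A → A → Prop)) (s := ((· ≥ ·) : B → B → Prop))
      (WellQuasiOrderedLE.wqo (α := Aᵒᵈ)) (WellQuasiOrderedLE.wqo (α := Bᵒᵈ))
  have : WellQuasiOrderedLE (A × B)ᵒᵈ := ⟨hwqo⟩
  have : WellFoundedGT (A × B) := ⟨(inferInstance : WellFoundedLT (A × B)ᵒᵈ).wf⟩
  refine ⟨{p | Maximal (· ∈ I.carrier) p}, ?_, ?_⟩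
  · exact (setOfPred_maximal_antichain _).swap.finite_of_wellQuasiOrdered hwqo
  · apply le_antisymm
    · intro p hp
      obtain ⟨q, hpq, hq⟩ := exists_maximal_ge_of_wellFoundedGT (· ∈ I.carrier) p hp
      exact ⟨q, .inl hq, hpq⟩
    · rintro p ⟨q, hq | hq, hpq⟩
      · exact I.hereditary hpq hq.prop
      · obtain ⟨a, b⟩ := q
        rcases hq with rfl | rfl
        · exact I.hereditary hpq (I.bot_mk_mem b)
        · exact I.hereditary hpq (I.mk_bot_mem a)

/-! ### The descending herringbone -/

/-- The descending herringbone, as a meet-subsemilattice of a product of two chains: the element `x`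
is encoded by the depths `i` and `j` of `x ∧ u₀` and `x ∧ v₀` in the chains of teeth. Depths live in
`WithTop ℕ∞`: natural numbers, then the depth `∞` of the least tooth, and finally `⊤`, which
stands for the zero of the lattice. So `uₙ = (n, ⊤)`, `vₙ = (⊤, n)`, `s₂ₙ = (n, n)` and
`s₂ₙ₊₁ = (n + 1, n)`. -/
@[ext]
structure Herringbone where
  /-- The depth of the meet with the largest left tooth. -/
  i : WithTop ℕ∞
  /-- The depth of the meet with the largest right tooth. -/
  j : WithTop ℕ∞
  rel : i = ⊤ ∨ j = ⊤ ∨ (j ≤ i ∧ i ≤ j + 1)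

namespace Herringbone

theorem depth_le_add_one (a : WithTop ℕ∞) : a ≤ a + 1 := le_self_add

theorem depth_add_one_eq_top {a : WithTop ℕ∞} : a + 1 = ⊤ ↔ a = ⊤ := by
  simp [WithTop.add_eq_top]

theorem depth_add_one_le {a b : WithTop ℕ∞} (h : a < b) : a + 1 ≤ b := by
  cases a with
  | top => exact absurd h not_top_lt
  | coe a =>
    cases b with
    | top => exact le_top
    | coe b => exact WithTop.coe_le_coe.2 (Order.add_one_le_of_lt (WithTop.coe_lt_coe.1 h))

/-- Larger elements have smaller depths. -/
instance : PartialOrder Herringbone where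
  le x y := y.i ≤ x.i ∧ y.j ≤ x.j
  le_refl _ := ⟨le_rfl, le_rfl⟩
  le_trans _ _ _ h₁ h₂ := ⟨h₂.1.trans h₁.1, h₂.2.trans h₁.2⟩
  le_antisymm _ _ h₁ h₂ := Herringbone.ext (le_antisymm h₂.1 h₁.1) (le_antisymm h₂.2 h₁.2)

theorem le_def {x y : Herringbone} : x ≤ y ↔ y.i ≤ x.i ∧ y.j ≤ x.j := Iff.rfl

open Classical in
/-- The least element of the herringbone whose depths are at most `a` and `b`. -/
noncomputable def ofDepths (a b : WithTop ℕ∞) : Herringbone where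
  i := if a = ⊤ ∨ b = ⊤ then a else min a (b + 1)
  j := if a = ⊤ ∨ b = ⊤ then b else min a b
  rel := by
    have h₁ := depth_le_add_one b
    have h₂ : min a (b + 1) ≤ min a b + 1 := by
      rw [min_add]; exact min_le_min_right _ (depth_le_add_one a)
    grind

theorem ofDepths_le_iff {a b : WithTop ℕ∞} {x : Herringbone} :
    ofDepths a b ≤ x ↔ x.i ≤ a ∧ x.j ≤ b := by
  have h₁ := x.rel
  have h₂ := depth_le_add_one b
  have h₃ : x.j ≤ b → x.j + 1 ≤ b + 1 := fun h => add_le_add_left h 1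
  have h₄ := @depth_add_one_eq_top b
  simp only [le_def, ofDepths]
  grind

noncomputable instance : Lattice Herringbone where
  sup x y := ofDepths (min x.i y.i) (min x.j y.j)
  le_sup_left x y := by
    have := (ofDepths_le_iff (a := min x.i y.i) (b := min x.j y.j)).1 le_rfl
    exact ⟨this.1.trans (min_le_left _ _), this.2.trans (min_le_left _ _)⟩
  le_sup_right x y := by
    have := (ofDepths_le_iff (a := min x.i y.i) (b := min x.j y.j)).1 le_rfl
    exact ⟨this.1.trans (min_le_right _ _), this.2.trans (min_le_right _ _)⟩
  sup_le _ _ _ h₁ h₂ := ofDepths_le_iff.2 ⟨le_min h₁.1 h₂.1, le_min h₁.2 h₂.2⟩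
  inf x y := ⟨max x.i y.i, max x.j y.j, by
    have h₁ := x.rel
    have h₂ := y.rel
    have h₃ : max x.j y.j + 1 = max (x.j + 1) (y.j + 1) := max_add ..
    grind⟩
  inf_le_left _ _ := ⟨le_max_left _ _, le_max_left _ _⟩
  inf_le_right _ _ := ⟨le_max_right _ _, le_max_right _ _⟩
  le_inf _ _ _ h₁ h₂ := ⟨max_le h₁.1 h₂.1, max_le h₁.2 h₂.2⟩

instance : OrderBot Herringbone where
  bot := ⟨⊤, ⊤, .inl rfl⟩
  bot_le _ := ⟨le_top, le_top⟩

theorem sup_def (x y : Herringbone) : x ⊔ y = ofDepths (min x.i y.i) (min x.j y.j) := rfl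

@[simp] theorem inf_i (x y : Herringbone) : (x ⊓ y).i = max x.i y.i := rfl

@[simp] theorem inf_j (x y : Herringbone) : (x ⊓ y).j = max x.j y.j := rfl

instance : WellQuasiOrderedLE Herringboneᵒᵈ := by
  have h : WellQuasiOrderedLE (WithTop ℕ∞ × WithTop ℕ∞) := inferInstance
  exact ⟨fun f => h.wqo fun n => ((OrderDual.ofDual (f n)).i, (OrderDual.ofDual (f n)).j)⟩

/-! ### 2-modularity -/

/-- The elements of the spine. They form an upper set, which is a chain. -/
def OnSpine (x : Herringbone) : Prop := x.i ≠ ⊤ ∧ x.j ≠ ⊤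

theorem OnSpine.total {x y : Herringbone} (hx : x.OnSpine) (hy : y.OnSpine) : x ≤ y ∨ y ≤ x := by
  obtain ⟨hx₁, hx₂⟩ := hx
  obtain ⟨hy₁, hy₂⟩ := hy
  have h₁ := x.rel
  have h₂ := y.rel
  have h₃ := @depth_add_one_le x.j y.j
  have h₄ := @depth_add_one_le y.j x.j
  simp only [le_def]
  grind

theorem onSpine_sup_iff {x y : Herringbone} :
    (x ⊔ y).OnSpine ↔ (x.i ≠ ⊤ ∨ y.i ≠ ⊤) ∧ (x.j ≠ ⊤ ∨ y.j ≠ ⊤) := by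
  have := @depth_add_one_eq_top (min x.j y.j)
  simp only [sup_def, OnSpine, ofDepths]
  grind

/-- The elements that meet `u₀` in zero form a chain, so an antichain contains at most one of them;
and likewise for `v₀`. -/
theorem onSpine_sup_inf {x y z : Herringbone} (hxy : ¬ x ≤ y) (hyx : ¬ y ≤ x) (hxz : ¬ x ≤ z)
    (hzx : ¬ z ≤ x) : (x ⊔ y ⊓ z).OnSpine := by
  simp only [le_def] at *
  rw [onSpine_sup_iff, inf_i, inf_j]
  grind

theorem isHModular_two : IsHModular 2 Herringbone := by
  rintro ⟨x, y, z⟩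
  rw [Function.iterate_succ_apply']
  by_cases h : x ≤ y ∨ y ≤ x ∨ y ≤ z ∨ z ≤ y ∨ z ≤ x ∨ x ≤ z
  · exact isFixedPt_tripleStep_iterate_of_comparable h
  · push Not at h
    obtain ⟨h₁, h₂, h₃, h₄, h₅, h₆⟩ := h
    have hx := onSpine_sup_inf h₁ h₂ h₆ h₅
    have hy := onSpine_sup_inf h₂ h₁ h₃ h₄
    have hz := onSpine_sup_inf h₅ h₆ h₄ h₃
    exact isFixedPt_tripleStep_tripleStep_of_chain (hx.total hy) (hy.total hz) (hx.total hz)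

/-! ### Generation by three elements -/

/-- The left tooth `uₙ`; `u_∞` for `n = ∞`. -/
def left (n : ℕ∞) : Herringbone := ⟨n, ⊤, .inr (.inl rfl)⟩

/-- The right tooth `vₙ`; `v_∞` for `n = ∞`. -/
def right (n : ℕ∞) : Herringbone := ⟨⊤, n, .inl rfl⟩

/-- The element `s₂ₙ` of the spine; `s_∞` for `n = ∞`. -/
def spineEven (n : ℕ∞) : Herringbone := ⟨n, n, .inr (.inr ⟨le_rfl, depth_le_add_one _⟩)⟩

/-- The element `s₂ₙ₊₁` of the spine; again `s_∞` for `n = ∞`. -/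
def spineOdd (n : ℕ∞) : Herringbone := ⟨n + 1, n, .inr (.inr ⟨depth_le_add_one _, le_rfl⟩)⟩

theorem left_sup_right_top (n : ℕ∞) : left n ⊔ right ⊤ = spineEven n := by
  have h : ((⊤ : ℕ∞) : WithTop ℕ∞) + 1 = ((⊤ : ℕ∞) : WithTop ℕ∞) := rfl
  ext1 <;> simp [sup_def, left, right, spineEven, ofDepths, h]

theorem left_top_sup_right (n : ℕ∞) : left ⊤ ⊔ right n = spineOdd n := by
  have h : (n : WithTop ℕ∞) + 1 ≤ ((⊤ : ℕ∞) : WithTop ℕ∞) := WithTop.coe_le_coe.2 le_top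
  ext1 <;> simp [sup_def, left, right, spineOdd, ofDepths, h]

theorem left_zero_inf_spineOdd (n : ℕ∞) : left 0 ⊓ spineOdd n = left (n + 1) := by
  ext1 <;> simp [left, spineOdd]

theorem right_zero_inf_spineEven (n : ℕ∞) : right 0 ⊓ spineEven n = right n := by
  ext1 <;> simp [right, spineEven]

theorem left_zero_inf_right_zero : left 0 ⊓ right 0 = ⊥ := by
  ext1 <;> simp [left, right] <;> rfl

theorem left_zero_inf_spineEven_top : left 0 ⊓ spineEven ⊤ = left ⊤ := by
  ext1 <;> simp [left, spineEven]

/-- Every element is a tooth, on the spine, or zero. -/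
theorem cases_eq (x : Herringbone) :
    x = ⊥ ∨ ∃ n, x = left n ∨ x = right n ∨ x = spineEven n ∨ x = spineOdd n := by
  obtain ⟨i, j, h⟩ := x
  induction i with
  | top =>
    induction j with
    | top => exact .inl rfl
    | coe n => exact .inr ⟨n, .inr (.inl rfl)⟩
  | coe m =>
    induction j with
    | top => exact .inr ⟨m, .inl rfl⟩
    | coe n =>
      right
      simp only [WithTop.coe_ne_top, false_or] at h
      rcases h.1.eq_or_lt with h' | h'
      · exact ⟨m, .inr (.inr (.inl (by ext1 <;> simp [spineEven, h'])))⟩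
      · have := le_antisymm h.2 (depth_add_one_le h')
        exact ⟨n, .inr (.inr (.inr (by ext1 <;> simp [spineOdd, this])))⟩

theorem latticeClosure_generators :
    latticeClosure {left 0, right 0, spineEven ⊤} = Set.univ := by
  set M := latticeClosure ({left 0, right 0, spineEven ⊤} : Set Herringbone)
  have hsub : IsSublattice M := isSublattice_latticeClosure
  have hgen : {left 0, right 0, spineEven ⊤} ⊆ M := subset_latticeClosure
  have hu₀ : left 0 ∈ M := hgen (by simp)
  have hv₀ : right 0 ∈ M := hgen (by simp)
  have hs : spineEven ⊤ ∈ M := hgen (by simp)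
  have hu_top : left ⊤ ∈ M := left_zero_inf_spineEven_top ▸ hsub.infClosed hu₀ hs
  have hv_top : right ⊤ ∈ M := right_zero_inf_spineEven ⊤ ▸ hsub.infClosed hv₀ hs
  have even_of_left {n : ℕ∞} (h : left n ∈ M) : spineEven n ∈ M :=
    left_sup_right_top n ▸ hsub.supClosed h hv_top
  have right_of_left {n : ℕ∞} (h : left n ∈ M) : right n ∈ M :=
    right_zero_inf_spineEven n ▸ hsub.infClosed hv₀ (even_of_left h)
  have odd_of_left {n : ℕ∞} (h : left n ∈ M) : spineOdd n ∈ M :=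
    left_top_sup_right n ▸ hsub.supClosed hu_top (right_of_left h)
  have hleft (n : ℕ∞) : left n ∈ M := by
    induction n with
    | top => exact hu_top
    | coe n =>
      induction n with
      | zero => exact hu₀
      | succ n ih =>
        have := hsub.infClosed hu₀ (odd_of_left ih)
        rw [left_zero_inf_spineOdd] at this
        exact_mod_cast this
  refine Set.eq_univ_of_forall fun x => ?_
  rcases cases_eq x with rfl | ⟨n, rfl | rfl | rfl | rfl⟩
  · exact left_zero_inf_right_zero ▸ hsub.infClosed hu₀ hv₀
  · exact hleft n
  · exact right_of_left (hleft n)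
  · exact even_of_left (hleft n)
  · exact odd_of_left (hleft n)

theorem isThreeGenerated : IsThreeGenerated Herringbone := by
  classical
  refine ⟨{left 0, right 0, spineEven ⊤}, Finset.card_eq_three.2 ⟨_, _, _, ?_, ?_, ?_, rfl⟩, ?_⟩
  · simp [left, right]
  · simp [left, spineEven]
  · simp [right, spineEven]
  · simpa using latticeClosure_generators

instance : Infinite Herringbone :=
  Infinite.of_injective left fun m n h => by simpa [left] using h

end Herringbone

theorem IsThreeGenerated.not_isLocallyFiniteLattice {L : Type*} [Lattice L] [Infinite L]
    (h : IsThreeGenerated L) : ¬ IsLocallyFiniteLattice L := by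
  obtain ⟨s, -, hs⟩ := h
  exact fun hL => Set.infinite_univ (hs ▸ hL s s.finite_toSet)

theorem theorem5p13 :
    (∃ (K : Type) (_ : Lattice K) (_ : OrderBot K),
      Infinite K ∧ IsThreeGenerated K ∧ IsHModular 2 K ∧ IsCappedTensorProd K K) ∧
    ¬ ∀ (A B : Type) [Lattice A] [OrderBot A] [Lattice B] [OrderBot B],
      IsCappedTensorProd A B → IsLocallyFiniteLattice A ∨ IsLocallyFiniteLattice B := by
  have hcapped : IsCappedTensorProd Herringbone Herringbone := fun I _ => I.isCapped
  refine ⟨⟨Herringbone, inferInstance, inferInstance, inferInstance,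
    Herringbone.isThreeGenerated, Herringbone.isHModular_two, hcapped⟩, fun H => ?_⟩
  exact (H _ _ hcapped).elim Herringbone.isThreeGenerated.not_isLocallyFiniteLattice
    Herringbone.isThreeGenerated.not_isLocallyFiniteLattice
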